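/- **Setting.** A *3-graph* $\mathbb G=(V,C_1,C_2,C_3)$ is a set $V$ with three irreflexive symmetric relations (*colors*) such that every pair of distinct vertices lies in exactly one of them. It is *homogeneous* if every isomorphism between two finite induced substructures extends to an automorphism. The *age* of $\mathbb G$ is the class of finite 3-graphs that embed in $\mathbb G$ as induced substructures. $\mathbb G$ *admits wqo* if for every well quasi-order $(X,\le)$ the following quasi-order on $X$-labelled structures of the age is a well quasi-order: $(a:\mathcal A\to X)\trianglelefteq_X(b:\mathcal B\to X)$ iff some embedding $h:\mathcal A\to\mathcal B$ satisfies $a(x)\le b(h(x))$ for all $x\in\mathcal A$. A bipartite graph with distinguishable sides is *universal* if for any two disjoint finite sets $S,T$ of vertices on one side (either one) some vertex on the other side is adjacent to all of $S$ and to none of $T$. It is *of type 2* if it is a perfect matching or the (bipartite) complement of a perfect matching; the bijection between the sides given by that matching is the bijection it *determines*. **Theorem.** Let $\mathbb G$ be a countably infinite homogeneous 3-graph, and let $c$ be a color such that $(V,c)$ is the disjoint union of finitely many infinite cliques $V_1,\dots,V_k$ (*layers*). Let $a\ne c$ be a color, and for $i\neq j$ let $\mathbb G_{i,j}$ be the bipartite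 graph with sides $V_i,V_j$ whose edges are the pairs of color $a$. Assume that no $\mathbb G_{i,j}$ with $i\ne j$ is universal. Then: 1. For all $i\ne j$, $\mathbb G_{i,j}$ is full, empty, a perfect matching, or the complement of a perfect matching. 2. Let $i,j,l$ be pairwise different, let $\mathbb G_{i,j}$ be of type 2 and let $\psi:V_i\to V_j$ be the bijection it determines. Then either $u\mathrel{a}v\Leftrightarrow\psi(u)\mathrel{a}v$ for all $u\in V_i$, $v\in V_l$, or $\neg(u\mathrel{a}v)\Leftrightarrow\psi(u)\mathrel{a}v$ for all $u\in V_i$, $v\in V_l$. 3. Let $i,j,l$ be pairwise different. If $\mathbb G_{i,j}$ and $\mathbb G_{j,l}$ are of type 2, then so is $\mathbb G_{i,l}$, and the determined bijections satisfy $f_{j,l}\circ f_{i,j}=f_{i,l}$. 4. There is a partition $V=\bigcup_{n\in\mathbb N}U_n$ such that every $U_n$ has exactly one vertex in each layer; whenever $\mathbb G_{i,j}$ ($i\ne j$) is of type 2 and determines $f_{i,j}$, $f_{i,j}$ maps $U_n\cap V_i$ into $U_n$ for every $n$; and for all $m,n$ there is an automorphism of $\mathbb G$ that maps each layer to itself,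 swaps $U_m$ and $U_n$, and is the identity elsewhere. 5. $\mathbb G$ admits wqo. -/

import Mathlib

universe u v

/-- A 3-graph on the vertex set `V`: three irreflexive symmetric binary relations (the three
colours) such that every pair of distinct vertices belongs to exactly one of them. -/
structure ThreeGraph (V : Type u) where
  color : Fin 3 → SimpleGraph V
  existsUnique_color : ∀ x y : V, x ≠ y → ∃! c : Fin 3, (color c).Adj x y

namespace ThreeGraph

/-- `h` is an embedding of 3-graphs: an isomorphism onto an induced substructure. -/
def IsEmbedding {V : Type u} {W : Type v} (G : ThreeGraph V) (H : ThreeGraph W)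
    (h : V → W) : Prop :=
  Function.Injective h ∧
    ∀ (c : Fin 3) (x y : V), (G.color c).Adj x y ↔ (H.color c).Adj (h x) (h y)

/-- The permutation `p` of the vertices is an automorphism of `G`. -/
def IsAutomorphism {V : Type u} (G : ThreeGraph V) (p : V ≃ V) : Prop :=
  ∀ (c : Fin 3) (x y : V), (G.color c).Adj x y ↔ (G.color c).Adj (p x) (p y)

/-- `G` is homogeneous: every isomorphism between two finite induced substructures extends to an
automorphism. -/
def IsHomogeneous {V : Type u} (G : ThreeGraph V) : Prop :=
  ∀ (A B : Finset V) (f : A ≃ B),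
    (∀ (c : Fin 3) (x y : A), (G.color c).Adj (x : V) y ↔ (G.color c).Adj (f x : V) (f y)) →
    ∃ p : V ≃ V, G.IsAutomorphism p ∧ ∀ x : A, p x = f x

/-! ### Admitting wqo -/

/-- A finite structure from the age of `G` (a finite 3-graph that embeds in `G`), whose vertices
are labelled by elements of `X`. -/
structure LabelledAge {V : Type u} (G : ThreeGraph V) (X : Type v) where
  carrier : Type
  finite : Finite carrier
  graph : ThreeGraph carrier
  mem_age : ∃ h : carrier → V, graph.IsEmbedding G h
  label : carrier → X

/-- The lifted embedding quasi-order on labelled finite structures. -/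
instance LabelledAge.instPreorder {V : Type u} (G : ThreeGraph V) (X : Type v) [Preorder X] :
    Preorder (LabelledAge G X) where
  le S T := ∃ h : S.carrier → T.carrier,
    S.graph.IsEmbedding T.graph h ∧ ∀ x, S.label x ≤ T.label (h x)
  le_refl S := ⟨id, ⟨Function.injective_id, fun _ _ _ => Iff.rfl⟩, fun _ => le_rfl⟩
  le_trans S T R := by
    rintro ⟨h, hh, hl⟩ ⟨g, hg, gl⟩
    exact ⟨g ∘ h, ⟨hg.1.comp hh.1, fun c x y => (hh.2 c x y).trans (hg.2 c _ _)⟩,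
      fun x => (hl x).trans (gl (h x))⟩

/-- `G` admits wqo: for every well quasi-order `X`, the lifted embedding order on finite
structures from the age of `G` labelled by `X` is a well quasi-order. -/
def AdmitsWQO {V : Type u} (G : ThreeGraph V) : Prop :=
  ∀ (X : Type v) [Preorder X] [WellQuasiOrderedLE X], WellQuasiOrderedLE (LabelledAge G X)

/-! ### Layers and the bipartite graphs between them -/

/-- The graph of colour `c` is the disjoint union of the `k` infinite cliques
`{x | layer x = i}`, `i : Fin k`. -/
structure IsLayering {V : Type u} (G : ThreeGraph V) (c : Fin 3) {k : ℕ}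
    (layer : V → Fin k) : Prop where
  infinite : ∀ i : Fin k, {x : V | layer x = i}.Infinite
  adj_iff : ∀ x y : V, (G.color c).Adj x y ↔ x ≠ y ∧ layer x = layer y

/-- The `i`-th layer. -/
abbrev Layer {V : Type u} {k : ℕ} (layer : V → Fin k) (i : Fin k) : Type u :=
  {x : V // layer x = i}

/-- The bipartite graph, with distinguishable sides, formed by the edges of colour `a` between
the layers `i` and `j`. -/
def between {V : Type u} (G : ThreeGraph V) (a : Fin 3) {k : ℕ} (layer : V → Fin k)
    (i j : Fin k) (x : Layer layer i) (y : Layer layer j) : Prop :=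
  (G.color a).Adj x.1 y.1

end ThreeGraph

/-! ### Bipartite graphs with distinguishable sides `A` and `B` -/

namespace Bip

/-- All possible edges are present. -/
def IsFull {A : Type u} {B : Type v} (E : A → B → Prop) : Prop := ∀ x y, E x y

/-- There are no edges. -/
def IsEdgeless {A : Type u} {B : Type v} (E : A → B → Prop) : Prop := ∀ x y, ¬ E x y

/-- The bipartite complement. -/
def compl {A : Type u} {B : Type v} (E : A → B → Prop) : A → B → Prop := fun x y => ¬ E x y

/-- Every vertex, on either side, lies on exactly one edge. -/
def IsPerfectMatching {A : Type u} {B : Type v} (E : A → B → Prop) : Prop :=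
  (∀ x, ∃! y, E x y) ∧ (∀ y, ∃! x, E x y)

/-- The graph is universal (also called generic or random): for any two disjoint finite sets of
vertices on one side, some vertex on the other side is adjacent to all vertices of the first set
and to none of the second. -/
def IsUniversal {A : Type u} {B : Type v} (E : A → B → Prop) : Prop :=
  (∀ S T : Finset A, Disjoint S T → ∃ y, (∀ x ∈ S, E x y) ∧ ∀ x ∈ T, ¬ E x y) ∧
  (∀ S T : Finset B, Disjoint S T → ∃ x, (∀ y ∈ S, E x y) ∧ ∀ y ∈ T, ¬ E x y)

/-- The graph is a perfect matching or the complement of one. -/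
def IsMatchingType {A : Type u} {B : Type v} (E : A → B → Prop) : Prop :=
  IsPerfectMatching E ∨ IsPerfectMatching (compl E)

/-- `E` is a perfect matching or the complement of one, and `f` is the bijection between its sides
given by that matching. -/
def Determines {A : Type u} {B : Type v} (E : A → B → Prop) (f : A ≃ B) : Prop :=
  (∀ x y, E x y ↔ f x = y) ∨ (∀ x y, compl E x y ↔ f x = y)

end Bip

namespace ThreeGraph

/-- The family `U` cuts the vertex set into slices: it is a partition, every slice has exactly one
vertex in every layer, the bijections between layers determined by the graphs `between` map every
slice to itself, and any two slices can be swapped by an automorphism of `G` that preserves the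
layers and is the identity elsewhere. -/
structure IsSlicing {V : Type u} (G : ThreeGraph V) (a : Fin 3) {k : ℕ} (layer : V → Fin k)
    (U : ℕ → Set V) : Prop where
  iUnion_eq : ⋃ n, U n = Set.univ
  disjoint : ∀ m n, m ≠ n → Disjoint (U m) (U n)
  existsUnique_mem : ∀ n i, ∃! x, x ∈ U n ∧ layer x = i
  map_mem : ∀ i j, i ≠ j → ∀ f : Layer layer i ≃ Layer layer j,
    Bip.Determines (G.between a layer i j) f → ∀ n x, x.1 ∈ U n → (f x).1 ∈ U n
  swap : ∀ m n, ∃ p : V ≃ V, G.IsAutomorphism p ∧ (∀ x, layer (p x) = layer x) ∧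
    p '' U m = U n ∧ p '' U n = U m ∧ ∀ x, x ∉ U m → x ∉ U n → p x = x

end ThreeGraph

/-! Automorphisms preserve `c`, hence permute the finitely many layers. By pigeonhole, enough of
them fix every layer setwise to act highly transitively on each single layer. So the bipartite graph
between two layers is homogeneous on either side, and outside the universal case counting
neighbourhoods leaves only the four forms (`Bip.four_forms_of_not_isUniversal`). Universality plays
no role after that.

In a graph of type 2 every vertex has a partner in the other layer, the one vertex to which it is
related exceptionally. Partners are definable from `a` and the layers, so automorphisms carry
partners to partners. This makes "equal or of type 2" an equivalence relation on layers
(`isMatchingType_between_trans`) and makes the bijections compose (`determines_comp`). Numbering one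
layer of each class and transporting the numbers along the bijections identifies `V` with `Fin k ×
ℕ`, where the color of a pair depends only on the two layers and on whether the numbers agree
(`exists_isCoordinates`). The sets of constant number are the slices, and every permutation of the
numbers is an automorphism.

For wqo, a labelled finite structure becomes a word whose letters are its slices, a letter being a
`k`-tuple of labels with `⊥` for absent vertices. Dickson's lemma orders the letters and Higman's
lemma the words. -/

/-! ### Homogeneous bipartite graphs -/

namespace Bip

variable {A : Type u} {B : Type v}

/-- Every injective map between finite sets of left vertices extends to an automorphism that
preserves the sides. -/
def IsLeftHomogeneous (E : A → B → Prop) : Prop :=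
  ∀ (S : Finset A) (f : A → A), Set.InjOn f S →
    ∃ (p : A ≃ A) (q : B ≃ B), (∀ x y, E x y ↔ E (p x) (q y)) ∧ ∀ x ∈ S, p x = f x

theorem IsLeftHomogeneous.compl {E : A → B → Prop} (h : IsLeftHomogeneous E) :
    IsLeftHomogeneous (compl E) := fun S f hf => by
  obtain ⟨p, q, hpq, hp⟩ := h S f hf
  exact ⟨p, q, fun x y => not_congr (hpq x y), hp⟩

/-- A finite set can be carried injectively onto any finite set of the same size. -/
theorem exists_injOn_image_eq [DecidableEq A] (S T : Finset A) (h : S.card = T.card) :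
    ∃ f : A → A, Set.InjOn f S ∧ S.image f = T := by
  classical
  let e := Finset.equivOfCardEq h
  refine ⟨fun x => if hx : x ∈ S then (e ⟨x, hx⟩ : A) else x, ?_, ?_⟩
  · intro x hx y hy hxy
    have hx' : x ∈ S := hx
    have hy' : y ∈ S := hy
    simp only [hx', hy', dif_pos] at hxy
    simpa using e.injective (Subtype.ext hxy)
  · ext y
    simp only [Finset.mem_image]
    constructor
    · rintro ⟨x, hx, rfl⟩
      simp [hx]
    · intro hy
      refine ⟨e.symm ⟨y, hy⟩, (e.symm ⟨y, hy⟩).2, ?_⟩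
      simp

/-- Automorphisms carry any two distinct left vertices to any other two. -/
theorem IsLeftHomogeneous.exists_pair {E : A → B → Prop} (h : IsLeftHomogeneous E)
    {x x' y y' : A} (hx : x ≠ x') (hy : y ≠ y') :
    ∃ (p : A ≃ A) (q : B ≃ B), (∀ x y, E x y ↔ E (p x) (q y)) ∧ p x = y ∧ p x' = y' := by
  classical
  obtain ⟨p, q, hpq, hp⟩ := h {x, x'} (fun z => if z = x then y else y') (by
    intro s hs t ht hst
    simp only [Finset.coe_insert, Finset.coe_singleton, Set.mem_insert_iff,
      Set.mem_singleton_iff] at hs ht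
    rcases hs with rfl | rfl <;> rcases ht with rfl | rfl <;>
      simp_all [hx.symm, hy.symm])
  exact ⟨p, q, hpq, by simpa using hp x (by simp), by simpa [hx.symm] using hp x' (by simp)⟩

/-- Homogeneity on the left turns every set of size `D₀.card` into a neighbourhood, while
homogeneity on the right makes all pairs of distinct right vertices alike. The two are compatible
only for very small neighbourhoods. -/
theorem isEdgeless_or_isPerfectMatching_of_finite [Infinite A] {E : A → B → Prop}
    (hA : IsLeftHomogeneous E) (hB : IsLeftHomogeneous (flip E)) {y₀ : B}
    (hfin : {x | E x y₀}.Finite) : IsEdgeless E ∨ IsPerfectMatching E := by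
  classical
  have trans : ∀ y, ∃ (p : A ≃ A) (q : B ≃ B), (∀ x y, E x y ↔ E (p x) (q y)) ∧ q y₀ = y := by
    intro y
    obtain ⟨q, p, hqp, hq⟩ := hB {y₀} (fun _ => y) (by simp)
    exact ⟨p, q, fun x y => hqp y x, by simpa using hq⟩
  let D₀ := hfin.toFinset
  have hD₀ : ∀ x, E x y₀ ↔ x ∈ D₀ := fun x => by simp [D₀]
  -- every set of the same size as `D₀` is a neighbourhood
  have all : ∀ D : Finset A, D.card = D₀.card → ∃ y, ∀ x, E x y ↔ x ∈ D := by
    intro D hD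
    obtain ⟨f, hf, hfD⟩ := exists_injOn_image_eq D₀ D hD.symm
    obtain ⟨p, q, hpq, hp⟩ := hA D₀ f hf
    refine ⟨q y₀, fun x => ?_⟩
    have h1 := hpq (p.symm x) y₀
    rw [p.apply_symm_apply] at h1
    rw [← h1, hD₀, ← hfD, Finset.mem_image]
    constructor
    · intro hx
      exact ⟨_, hx, by rw [← hp _ hx, p.apply_symm_apply]⟩
    · rintro ⟨z, hz, rfl⟩
      rwa [← hp z hz, p.symm_apply_apply]
  rcases Nat.lt_or_ge D₀.card 1 with hd | hd
  · left
    intro x y hxy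
    obtain ⟨p, q, hpq, rfl⟩ := trans y
    have h0 : D₀ = ∅ := by simpa using hd
    have h1 := hpq (p.symm x) y₀
    rw [p.apply_symm_apply] at h1
    have h2 := (hD₀ _).1 (h1.2 hxy)
    simp [h0] at h2
  right
  obtain ⟨z, hz⟩ := Infinite.exists_notMem_finset D₀
  obtain ⟨x₁, hx₁⟩ := Finset.card_pos.1 hd
  -- the neighbourhoods have one element
  have hd1 : D₀.card = 1 := by
    by_contra hne
    obtain ⟨x₂, hx₂, hx₂₁⟩ := Finset.exists_mem_ne (by omega : 1 < D₀.card) x₁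
    -- The neighbourhood of `y₁` differs from `D₀` but still shares `x₂` with it; that of `y₂` is
    -- disjoint from `D₀`. No automorphism can take the pair `y₀, y₁` to `y₀, y₂`.
    obtain ⟨y₁, hy₁⟩ := all (insert z (D₀.erase x₁)) (by
      rw [Finset.card_insert_of_notMem (by simp [hz]), Finset.card_erase_of_mem hx₁]
      omega)
    obtain ⟨D₂, hD₂, hD₂c⟩ :=
      (D₀.finite_toSet.infinite_compl : ((D₀ : Set A)ᶜ).Infinite).exists_subset_card_eq D₀.card
    obtain ⟨y₂, hy₂⟩ := all D₂ hD₂c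
    have hy₁₀ : y₀ ≠ y₁ := by
      rintro rfl
      exact hz ((hD₀ z).1 ((hy₁ z).2 (by simp)))
    have hy₂₀ : y₀ ≠ y₂ := by
      rintro rfl
      exact hD₂ ((hy₂ x₁).1 ((hD₀ x₁).2 hx₁)) hx₁
    obtain ⟨q, p, hqp, hq₀, hq₁⟩ := hB.exists_pair hy₁₀ hy₂₀
    have e0 : E (p x₂) y₀ := by
      have := (hqp y₀ x₂).1 ((hD₀ x₂).2 hx₂)
      rwa [hq₀] at this
    have e2 : E (p x₂) y₂ := by
      have := (hqp y₁ x₂).1 ((hy₁ x₂).2 (by simp [hx₂, hx₂₁]))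
      rwa [hq₁] at this
    exact hD₂ ((hy₂ _).1 e2) ((hD₀ _).1 e0)
  have single : ∀ x, ∃ y, ∀ x', E x' y ↔ x' = x := by
    intro x
    obtain ⟨y, hy⟩ := all {x} (by simp [hd1])
    exact ⟨y, by simpa using hy⟩
  have right : ∀ y, ∃ x, ∀ x', E x' y ↔ x' = x := by
    intro y
    obtain ⟨p, q, hpq, rfl⟩ := trans y
    obtain ⟨x, hx⟩ := Finset.card_eq_one.1 hd1
    refine ⟨p x, fun x' => ?_⟩
    have h1 := hpq (p.symm x') y₀
    rw [p.apply_symm_apply, hD₀, hx, Finset.mem_singleton, Equiv.symm_apply_eq] at h1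
    exact h1.symm
  refine ⟨fun x => ?_, fun y => ?_⟩
  · obtain ⟨y, hy⟩ := single x
    refine ⟨y, (hy x).2 rfl, fun y' hy' => ?_⟩
    by_contra hne
    -- If `y` and `y'` share the neighbour `x`, then by pair transitivity so do `y` and `y''`, whose
    -- neighbourhoods are the distinct singletons of `x` and `x'`.
    obtain ⟨x', hx'⟩ := exists_ne x
    obtain ⟨y'', hy''⟩ := single x'
    have hyy : y ≠ y'' := by
      rintro rfl
      exact hx' ((hy x').1 ((hy'' x').2 rfl))
    obtain ⟨q, p, hqp, hq₀, hq₁⟩ := hB.exists_pair (Ne.symm hne : y ≠ y') hyy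
    have e0 := (hqp y x).1 ((hy x).2 rfl)
    have e1 := (hqp y' x).1 hy'
    change E (p x) (q y) at e0
    change E (p x) (q y') at e1
    rw [hq₀, hy] at e0
    rw [hq₁, hy''] at e1
    exact hx' (e1.symm.trans e0)
  · obtain ⟨x, hx⟩ := right y
    exact ⟨x, (hx x).2 rfl, fun x' h => (hx x').1 h⟩

theorem isFull_iff_isEdgeless_compl {E : A → B → Prop} :
    IsFull E ↔ IsEdgeless (Bip.compl E) := by
  simp [IsFull, IsEdgeless, Bip.compl]

/-- If two disjoint finite sets on the left cannot be separated by a right vertex then the graph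
has one of the four non-universal forms. -/
theorem four_forms_of_not_separated [Infinite A] [Infinite B] {E : A → B → Prop}
    (hA : IsLeftHomogeneous E) (hB : IsLeftHomogeneous (flip E)) {S T : Finset A}
    (hST : Disjoint S T) (hno : ¬ ∃ y, (∀ x ∈ S, E x y) ∧ ∀ x ∈ T, ¬ E x y) :
    IsFull E ∨ IsEdgeless E ∨ IsPerfectMatching E ∨ IsPerfectMatching (Bip.compl E) := by
  classical
  obtain ⟨y₀⟩ : Nonempty B := inferInstance
  by_cases h1 : {x | E x y₀}.Finite
  · rcases isEdgeless_or_isPerfectMatching_of_finite hA hB h1 with h | h <;> simp [h]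
  by_cases h2 : {x | Bip.compl E x y₀}.Finite
  · rcases isEdgeless_or_isPerfectMatching_of_finite hA.compl
      (hB.compl : IsLeftHomogeneous (Bip.compl (flip E))) h2 with h | h
    · exact Or.inl (isFull_iff_isEdgeless_compl.2 h)
    · simp [h]
  exfalso
  -- Both the neighbours and the non-neighbours of `y₀` are infinite in number, so `S` fits among
  -- the former and `T` among the latter. Pulling `y₀` back along an automorphism extending this map
  -- separates `S` from `T`.
  obtain ⟨f, hf, hfi⟩ := S.finite_toSet.exists_injOn_of_encard_le (t := {x | E x y₀})
    (by rw [Set.Infinite.encard_eq h1]; exact le_top)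
  obtain ⟨g, hg, hgi⟩ := T.finite_toSet.exists_injOn_of_encard_le (t := {x | Bip.compl E x y₀})
    (by rw [Set.Infinite.encard_eq h2]; exact le_top)
  have hd : ∀ x ∈ T, x ∉ S := fun x hx hx' => Finset.disjoint_left.1 hST hx' hx
  obtain ⟨p, q, hpq, hp⟩ := hA (S ∪ T) (fun x => if x ∈ S then f x else g x) (by
    intro x hx y hy hxy
    by_cases hxS : x ∈ S <;> by_cases hyS : y ∈ S <;> simp only [hxS, hyS, if_true, if_false] at hxy
    · exact hfi hxS hyS hxy
    · have hyT : y ∈ T := by simpa [hyS] using hy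
      have a1 : E (f x) y₀ := hf hxS
      have a2 : ¬ E (g y) y₀ := hg hyT
      exact absurd (hxy ▸ a1) a2
    · have hxT : x ∈ T := by simpa [hxS] using hx
      have a1 : E (f y) y₀ := hf hyS
      have a2 : ¬ E (g x) y₀ := hg hxT
      exact absurd (hxy ▸ a1) a2
    · have hyT : y ∈ T := by simpa [hyS] using hy
      have hxT : x ∈ T := by simpa [hxS] using hx
      exact hgi hxT hyT hxy)
  refine hno ⟨q.symm y₀, fun x hx => ?_, fun x hx => ?_⟩
  · rw [hpq, q.apply_symm_apply, hp x (by simp [hx]), if_pos hx]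
    exact hf hx
  · rw [hpq, q.apply_symm_apply, hp x (by simp [hx]), if_neg (hd x hx)]
    exact hg hx

theorem IsPerfectMatching.flip {E : A → B → Prop} (h : IsPerfectMatching E) :
    IsPerfectMatching (flip E) := ⟨h.2, h.1⟩

/-- A homogeneous bipartite graph that is not universal is full, edgeless, a perfect matching or
the complement of one. -/
theorem four_forms_of_not_isUniversal [Infinite A] [Infinite B] {E : A → B → Prop}
    (hA : IsLeftHomogeneous E) (hB : IsLeftHomogeneous (flip E)) (hnu : ¬ IsUniversal E) :
    IsFull E ∨ IsEdgeless E ∨ IsPerfectMatching E ∨ IsPerfectMatching (Bip.compl E) := by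
  rw [IsUniversal, not_and_or] at hnu
  rcases hnu with h | h <;> push Not at h <;> obtain ⟨S, T, hST, h⟩ := h
  · exact four_forms_of_not_separated hA hB hST (by push Not; exact h)
  · rcases four_forms_of_not_separated hB (hA : IsLeftHomogeneous (_root_.flip (_root_.flip E)))
      hST (by push Not; exact h) with h | h | h | h
    · exact Or.inl fun x y => h y x
    · exact Or.inr (Or.inl fun x y => h y x)
    · exact Or.inr (Or.inr (Or.inl h.flip))
    · exact Or.inr (Or.inr (Or.inr h.flip))

end Bip

/-! ### Automorphisms that preserve the layers -/

namespace ThreeGraph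

variable {V : Type u} {G : ThreeGraph V} {a c : Fin 3} {k : ℕ} {layer : V → Fin k}

theorem color_eq_of_adj {d e : Fin 3} {x y : V} (hd : (G.color d).Adj x y)
    (he : (G.color e).Adj x y) : d = e :=
  (G.existsUnique_color x y hd.ne).unique hd he

/-- Two colours determine the third. -/
theorem adj_iff_of_two (hac : a ≠ c) {W : Type v} {H : ThreeGraph W} {x y : V} {x' y' : W}
    (hne : x ≠ y ↔ x' ≠ y')
    (ha : (G.color a).Adj x y ↔ (H.color a).Adj x' y')
    (hc : (G.color c).Adj x y ↔ (H.color c).Adj x' y') (d : Fin 3) :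
    (G.color d).Adj x y ↔ (H.color d).Adj x' y' := by
  by_cases hxy : x = y
  · have hxy' : x' = y' := by simpa [hxy] using hne
    simp [hxy, hxy']
  by_cases hda : d = a
  · rwa [hda]
  by_cases hdc : d = c
  · rwa [hdc]
  have third : ∀ a c d : Fin 3, a ≠ c → d ≠ a → d ≠ c → ∀ e, e = a ∨ e = c ∨ e = d := by decide
  replace third := third a c d hac hda hdc
  obtain ⟨e, he, -⟩ := G.existsUnique_color x y hxy
  obtain ⟨e', he', -⟩ := H.existsUnique_color x' y' (hne.1 hxy)
  constructor
  · intro hd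
    rcases third e' with rfl | rfl | rfl
    · exact absurd (color_eq_of_adj hd (ha.2 he')) hda
    · exact absurd (color_eq_of_adj hd (hc.2 he')) hdc
    · exact he'
  · intro hd
    rcases third e with rfl | rfl | rfl
    · exact absurd (color_eq_of_adj hd (ha.1 he)) hda
    · exact absurd (color_eq_of_adj hd (hc.1 he)) hdc
    · exact he

theorem IsAutomorphism.trans {p q : V ≃ V} (hp : G.IsAutomorphism p) (hq : G.IsAutomorphism q) :
    G.IsAutomorphism (p.trans q) := fun d x y => (hp d x y).trans (hq d _ _)

theorem IsAutomorphism.symm {p : V ≃ V} (hp : G.IsAutomorphism p) :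
    G.IsAutomorphism p.symm := fun d x y => by
  rw [hp d (p.symm x) (p.symm y), p.apply_symm_apply, p.apply_symm_apply]

theorem IsHomogeneous.exists_extend (hG : G.IsHomogeneous) (S : Finset V) (f : V → V)
    (hf : Set.InjOn f S)
    (hc : ∀ d, ∀ x ∈ S, ∀ y ∈ S, (G.color d).Adj x y ↔ (G.color d).Adj (f x) (f y)) :
    ∃ p : V ≃ V, G.IsAutomorphism p ∧ ∀ x ∈ S, p x = f x := by
  classical
  let e : S ≃ S.image f := Equiv.ofBijective
    (fun x => ⟨f x, Finset.mem_image_of_mem f x.2⟩) (by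
      constructor
      · intro x y hxy
        exact Subtype.ext (hf x.2 y.2 (congrArg Subtype.val hxy))
      · rintro ⟨y, hy⟩
        obtain ⟨x, hx, rfl⟩ := Finset.mem_image.1 hy
        exact ⟨⟨x, hx⟩, rfl⟩)
  obtain ⟨p, hp, hpe⟩ := hG S (S.image f) e fun d x y => hc d x x.2 y y.2
  exact ⟨p, hp, fun x hx => hpe ⟨x, hx⟩⟩

namespace IsLayering

theorem adj_iff_of_layer_eq (h : G.IsLayering c layer) {x y : V} (hxy : layer x = layer y)
    (d : Fin 3) : (G.color d).Adj x y ↔ x ≠ y ∧ d = c := by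
  constructor
  · intro hd
    exact ⟨hd.ne, color_eq_of_adj hd ((h.adj_iff x y).2 ⟨hd.ne, hxy⟩)⟩
  · rintro ⟨hne, rfl⟩
    exact (h.adj_iff x y).2 ⟨hne, hxy⟩

theorem layer_eq_iff (h : G.IsLayering c layer) {p : V ≃ V} (hp : G.IsAutomorphism p) (x y : V) :
    layer (p x) = layer (p y) ↔ layer x = layer y := by
  by_cases hxy : x = y
  · simp [hxy]
  have := hp c x y
  rw [h.adj_iff, h.adj_iff] at this
  simpa [hxy] using this.symm

theorem infinite_layer (h : G.IsLayering c layer) (i : Fin k) : Infinite (Layer layer i) :=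
  (h.infinite i).to_subtype

theorem nonempty_layer (h : G.IsLayering c layer) (i : Fin k) : Nonempty (Layer layer i) :=
  (h.infinite i).nonempty.to_subtype

/-- A finite injective map from a layer to itself extends to an automorphism. -/
theorem exists_extend (h : G.IsLayering c layer) (hG : G.IsHomogeneous) {i : Fin k}
    (S : Finset V) (f : V → V) (hf : Set.InjOn f S) (hS : ∀ x ∈ S, layer x = i)
    (hfS : ∀ x ∈ S, layer (f x) = i) :
    ∃ p : V ≃ V, G.IsAutomorphism p ∧ ∀ x ∈ S, p x = f x := by
  refine hG.exists_extend S f hf fun d x hx y hy => ?_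
  rw [h.adj_iff_of_layer_eq ((hS x hx).trans (hS y hy).symm),
    h.adj_iff_of_layer_eq ((hfS x hx).trans (hfS y hy).symm), ne_eq, ne_eq, hf.eq_iff hx hy]

/-- The layer-preserving automorphisms that fix a finite subset of a layer pointwise are
transitive on the rest of that layer. -/
theorem exists_fixing (h : G.IsLayering c layer) (hG : G.IsHomogeneous) {i : Fin k}
    {S : Finset V} (hS : ∀ x ∈ S, layer x = i) {u w : V} (hu : layer u = i) (hw : layer w = i)
    (huS : u ∉ S) (hwS : w ∉ S) :
    ∃ p : V ≃ V, G.IsAutomorphism p ∧ (∀ x, layer (p x) = layer x) ∧ (∀ x ∈ S, p x = x) ∧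
      p u = w := by
  classical
  by_cases huw : u = w
  · exact ⟨Equiv.refl V, fun _ _ _ => Iff.rfl, fun _ => rfl, fun _ _ => rfl, huw⟩
  -- Homogeneity gives, for each of infinitely many `v`, an automorphism `t v` that fixes `S` and
  -- takes `u` to `v`, but may permute the layers. One vertex `pt j` per layer records that
  -- permutation, and two of the finitely many permutations must coincide.
  have : Infinite ({x | layer x = i} \ (S : Set V) : Set V) :=
    ((h.infinite i).sdiff S.finite_toSet).to_subtype
  have move : ∀ v : ({x | layer x = i} \ (S : Set V) : Set V), ∃ p : V ≃ V,
      G.IsAutomorphism p ∧ (∀ x ∈ S, p x = x) ∧ p u = v := by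
    rintro ⟨v, hvi, hvS⟩
    have hvS : v ∉ S := hvS
    have hvi : layer v = i := hvi
    obtain ⟨p, hp, hpS⟩ := h.exists_extend hG (i := i) (insert u S)
      (fun x => if x = u then v else x) (by
        intro x hx y hy hxy
        rw [Finset.mem_coe, Finset.mem_insert] at hx hy
        grind) (by grind) (by grind)
    refine ⟨p, hp, fun x hx => ?_, by simpa using hpS u (by simp)⟩
    rw [hpS x (by simp [hx]), if_neg (by rintro rfl; exact huS hx)]
  choose t ht htS htu using move
  choose pt hpt using fun j => (h.infinite j).nonempty
  obtain ⟨v, v', hvv, hπ⟩ := Finite.exists_ne_map_eq_of_infinite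
    fun v => fun j : Fin k => layer (t v (pt j))
  -- the two automorphisms permute the layers in the same way
  have same : ∀ x, layer (t v x) = layer (t v' x) := by
    intro x
    have e : layer (pt (layer x)) = layer x := hpt (layer x)
    rw [← (h.layer_eq_iff (ht v) _ _).2 e, ← (h.layer_eq_iff (ht v') _ _).2 e]
    exact congrFun hπ (layer x)
  have hne : (v : V) ≠ v' := fun e => hvv (Subtype.ext e)
  -- `t v'` after the inverse of `t v` preserves the layers and takes `v` to `v'`. Conjugating by
  -- `r` keeps the layers and turns this into a move from `u` to `w`, even if `r` itself permutes
  -- layers.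
  obtain ⟨r, hr, hrS⟩ := h.exists_extend hG (i := i) (insert (v : V) (insert (v' : V) S))
    (fun x => if x = v then u else if x = v' then w else x) (by
      have h1 := v.2.2
      have h2 := v'.2.2
      intro x hx y hy hxy
      rw [Finset.mem_coe, Finset.mem_insert, Finset.mem_insert] at hx hy
      grind) (by
      have h1 : layer v = i := v.2.1
      have h2 : layer v' = i := v'.2.1
      grind) (by grind)
  have hrv : r v = u := by simpa using hrS v (by simp)
  have hrv' : r v' = w := by simpa [hne.symm] using hrS v' (by simp)
  have hrfix : ∀ x ∈ S, r x = x := by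
    intro x hx
    have h1 : (v : V) ∉ S := v.2.2
    have h2 : (v' : V) ∉ S := v'.2.2
    rw [hrS x (by simp [hx]), if_neg (by rintro rfl; exact h1 hx),
      if_neg (by rintro rfl; exact h2 hx)]
  refine ⟨((r.symm.trans (t v).symm).trans (t v')).trans r,
    ((hr.symm.trans (ht v).symm).trans (ht v')).trans hr, fun x => ?_, fun x hx => ?_, ?_⟩
  · have e : layer (t v' ((t v).symm (r.symm x))) = layer (r.symm x) := by
      rw [← same, Equiv.apply_symm_apply]
    simpa using (h.layer_eq_iff hr _ _).2 e
  · have e1 : r.symm x = x := by rw [Equiv.symm_apply_eq, hrfix x hx]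
    have e2 : (t v).symm x = x := by rw [Equiv.symm_apply_eq, htS v x hx]
    simp [e1, e2, htS v' x hx, hrfix x hx]
  · have e1 : r.symm u = v := by rw [Equiv.symm_apply_eq, hrv]
    have e2 : (t v).symm v = u := by rw [Equiv.symm_apply_eq, htu]
    simp [e1, e2, htu, hrv']

/-- The layer-preserving automorphisms are highly transitive on every layer. -/
theorem exists_layer_preserving (h : G.IsLayering c layer) (hG : G.IsHomogeneous) {i : Fin k}
    (S : Finset V) (f : V → V) (hf : Set.InjOn f S) (hS : ∀ x ∈ S, layer x = i)
    (hfS : ∀ x ∈ S, layer (f x) = i) :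
    ∃ p : V ≃ V, G.IsAutomorphism p ∧ (∀ x, layer (p x) = layer x) ∧ ∀ x ∈ S, p x = f x := by
  classical
  induction S using Finset.induction_on with
  | empty => exact ⟨Equiv.refl V, fun _ _ _ => Iff.rfl, fun _ => rfl, by simp⟩
  | insert u S hu ih =>
    obtain ⟨p, hp, hpl, hpS⟩ := ih (hf.mono (by simp)) (fun x hx => hS x (by simp [hx]))
      (fun x hx => hfS x (by simp [hx]))
    -- `p` is already right on `S`; `q` corrects its value at `u` while fixing the images of `S`.
    obtain ⟨q, hq, hql, hqS, hqu⟩ := h.exists_fixing hG (i := i) (S := S.image f) (u := p u)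
      (w := f u) (by
        intro x hx
        obtain ⟨y, hy, rfl⟩ := Finset.mem_image.1 hx
        exact hfS y (by simp [hy])) (by rw [hpl]; exact hS u (by simp)) (hfS u (by simp)) (by
        intro hx
        obtain ⟨y, hy, hyu⟩ := Finset.mem_image.1 hx
        rw [← hpS y hy] at hyu
        exact hu (p.injective hyu ▸ hy)) (by
        intro hx
        obtain ⟨y, hy, hyu⟩ := Finset.mem_image.1 hx
        exact hu (hf (by simp [hy]) (by simp) hyu ▸ hy))
    refine ⟨p.trans q, hp.trans hq, fun x => (hql _).trans (hpl x), fun x hx => ?_⟩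
    rcases Finset.mem_insert.1 hx with rfl | hx
    · exact hqu
    · rw [Equiv.trans_apply, hpS x hx, hqS _ (Finset.mem_image_of_mem f hx)]

end IsLayering

/-- The restriction of a layer-preserving permutation to a layer. -/
def layerPerm {p : V ≃ V} (hp : ∀ x, layer (p x) = layer x) (i : Fin k) :
    Layer layer i ≃ Layer layer i :=
  p.subtypeEquiv fun x => by rw [hp]

theorem flip_between (i j : Fin k) :
    flip (G.between a layer i j) = G.between a layer j i := by
  funext x y
  exact propext ((G.color a).adj_comm _ _)

theorem IsLayering.isLeftHomogeneous_between (h : G.IsLayering c layer) (hG : G.IsHomogeneous)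
    (a : Fin 3) (i j : Fin k) : Bip.IsLeftHomogeneous (G.between a layer i j) := by
  classical
  intro S f hf
  let F : V → V := fun x => if hx : layer x = i then f ⟨x, hx⟩ else x
  have hF : ∀ x : Layer layer i, F x = f x := fun x => dif_pos x.2
  obtain ⟨p, hp, hpl, hpS⟩ := h.exists_layer_preserving hG (i := i)
    (S.map (Function.Embedding.subtype _)) F (by
      intro x hx y hy hxy
      simp only [Finset.coe_map, Set.mem_image, Finset.mem_coe] at hx hy
      obtain ⟨x, hx, rfl⟩ := hx
      obtain ⟨y, hy, rfl⟩ := hy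
      rw [Function.Embedding.subtype_apply, Function.Embedding.subtype_apply, hF, hF] at hxy
      exact congrArg _ (hf hx hy (Subtype.ext hxy))) (by
      intro x hx
      obtain ⟨x, -, rfl⟩ := Finset.mem_map.1 hx
      exact x.2) (by
      intro x hx
      obtain ⟨x, -, rfl⟩ := Finset.mem_map.1 hx
      rw [Function.Embedding.subtype_apply, hF]
      exact (f x).2)
  exact ⟨layerPerm hpl i, layerPerm hpl j, fun x y => hp a x y, fun x hx => Subtype.ext
    ((hpS x (Finset.mem_map_of_mem _ hx)).trans (hF x))⟩

theorem IsLayering.four_forms (h : G.IsLayering c layer) (hG : G.IsHomogeneous)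
    {i j : Fin k} (hnu : ¬ Bip.IsUniversal (G.between a layer i j)) :
    Bip.IsFull (G.between a layer i j) ∨
    Bip.IsEdgeless (G.between a layer i j) ∨
    Bip.IsPerfectMatching (G.between a layer i j) ∨
    Bip.IsPerfectMatching (Bip.compl (G.between a layer i j)) := by
  have := h.infinite_layer i
  have := h.infinite_layer j
  exact Bip.four_forms_of_not_isUniversal (h.isLeftHomogeneous_between hG a i j)
    (by rw [flip_between]; exact h.isLeftHomogeneous_between hG a j i) hnu

end ThreeGraph

/-! ### Matching bijections and partners -/

namespace Bip

variable {A : Type u} {B : Type v} {E : A → B → Prop}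

theorem IsPerfectMatching.exists_equiv (h : IsPerfectMatching E) :
    ∃ f : A ≃ B, ∀ x y, E x y ↔ f x = y := by
  choose f hf hfu using h.1
  choose g hg hgu using h.2
  refine ⟨⟨f, g, fun x => (hgu _ x (hf x)).symm, fun y => (hfu _ y (hg y)).symm⟩, fun x y => ?_⟩
  exact ⟨fun hxy => (hfu x y hxy).symm, by rintro rfl; exact hf x⟩

theorem isPerfectMatching_of_equiv {f : A ≃ B} (h : ∀ x y, E x y ↔ f x = y) :
    IsPerfectMatching E :=
  ⟨fun x => ⟨f x, (h x _).2 rfl, fun y hy => ((h x y).1 hy).symm⟩,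
    fun y => ⟨f.symm y, (h _ y).2 (f.apply_symm_apply y),
      fun x hx => f.eq_symm_apply.2 ((h x y).1 hx)⟩⟩

theorem isMatchingType_iff : IsMatchingType E ↔ ∃ f, Determines E f := by
  constructor
  · rintro (h | h) <;> obtain ⟨f, hf⟩ := h.exists_equiv
    exacts [⟨f, Or.inl hf⟩, ⟨f, Or.inr hf⟩]
  · rintro ⟨f, hf | hf⟩
    exacts [Or.inl (isPerfectMatching_of_equiv hf), Or.inr (isPerfectMatching_of_equiv hf)]

theorem IsMatchingType.flip (h : IsMatchingType E) : IsMatchingType (flip E) :=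
  h.imp IsPerfectMatching.flip IsPerfectMatching.flip

theorem Determines.flip {f : A ≃ B} (h : Determines E f) : Determines (flip E) f.symm := by
  rcases h with h | h
  · exact Or.inl fun y x => (h x y).trans (by rw [Equiv.symm_apply_eq, eq_comm])
  · exact Or.inr fun y x => (h x y).trans (by rw [Equiv.symm_apply_eq, eq_comm])

end Bip

namespace ThreeGraph

variable {V : Type u} {G : ThreeGraph V} {a c : Fin 3} {k : ℕ} {layer : V → Fin k}

/-- The vertices `x` and `y` lie in different layers, and `y` is the only vertex of its layer that
is joined, or the only one that is not joined, to `x` by the colour `a`. -/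
def IsPartner (G : ThreeGraph V) (a : Fin 3) (layer : V → Fin k) (x y : V) : Prop :=
  layer x ≠ layer y ∧
    ((∀ z, layer z = layer y → ((G.color a).Adj x z ↔ z = y)) ∨
      ∀ z, layer z = layer y → (¬ (G.color a).Adj x z ↔ z = y))

/-- The automorphism need not preserve the layers: it suffices that it maps layers onto layers. -/
theorem IsPartner.map (h : G.IsLayering c layer) {p : V ≃ V} (hp : G.IsAutomorphism p) {x y : V}
    (hxy : G.IsPartner a layer x y) : G.IsPartner a layer (p x) (p y) := by
  have key : ∀ z, layer z = layer (p y) → layer (p.symm z) = layer y := fun z hz =>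
    (h.layer_eq_iff hp _ _).1 (by rwa [p.apply_symm_apply])
  have adj : ∀ z, (G.color a).Adj (p x) z ↔ (G.color a).Adj x (p.symm z) := fun z => by
    rw [hp a x, p.apply_symm_apply]
  refine ⟨fun e => hxy.1 ((h.layer_eq_iff hp _ _).1 e), hxy.2.imp ?_ ?_⟩
  · intro H z hz
    rw [adj, H _ (key z hz), Equiv.symm_apply_eq]
  · intro H z hz
    rw [adj, H _ (key z hz), Equiv.symm_apply_eq]

/-- A layer has a vertex outside any given finite set. -/
theorem IsLayering.exists_notMem (h : G.IsLayering c layer) (i : Fin k) (S : Finset V) :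
    ∃ x, layer x = i ∧ x ∉ S := by
  obtain ⟨x, hx, hxS⟩ := (h.infinite i).exists_notMem_finset S
  exact ⟨x, hx, hxS⟩

/-- If one partner is the exceptional edge and the other the exceptional non-edge, a third vertex
`z` of their layer would have to be both joined and not joined to `x`. -/
theorem IsPartner.unique (h : G.IsLayering c layer) {x y y' : V} (hxy : G.IsPartner a layer x y)
    (hxy' : G.IsPartner a layer x y') (hyy : layer y = layer y') : y = y' := by
  classical
  obtain ⟨z, hz, hzn⟩ := h.exists_notMem (layer y) {y, y'}
  simp only [Finset.mem_insert, Finset.mem_singleton, not_or] at hzn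
  obtain ⟨hz1, hz2⟩ := hzn
  rcases hxy.2 with H | H <;> rcases hxy'.2 with H' | H'
  · exact (H' y hyy).1 ((H y rfl).2 rfl)
  · exact absurd ((H z hz).1 (not_not.1 fun e => hz2 ((H' z (hz.trans hyy)).1 e))) hz1
  · exact absurd ((H' z (hz.trans hyy)).1 (not_not.1 fun e => hz1 ((H z hz).1 e))) hz2
  · exact (H' y hyy).1 ((H y rfl).2 rfl)

theorem isPartner_of_determines {i j : Fin k} (hij : i ≠ j)
    {f : Layer layer i ≃ Layer layer j} (hf : Bip.Determines (G.between a layer i j) f)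
    (x : Layer layer i) : G.IsPartner a layer x (f x) := by
  have e1 := x.2
  have e2 := (f x).2
  refine ⟨by rwa [e1, e2], hf.imp ?_ ?_⟩
  · intro H z hz
    refine (H x ⟨z, hz.trans e2⟩).trans ?_
    rw [eq_comm, Subtype.ext_iff]
  · intro H z hz
    refine (H x ⟨z, hz.trans e2⟩).trans ?_
    rw [eq_comm, Subtype.ext_iff]

theorem IsPartner.eq_of_determines (h : G.IsLayering c layer) {i j : Fin k} (hij : i ≠ j)
    {f : Layer layer i ≃ Layer layer j} (hf : Bip.Determines (G.between a layer i j) f)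
    {x : Layer layer i} {y : V} (hy : layer y = j) (hxy : G.IsPartner a layer x y) : f x = y :=
  (isPartner_of_determines hij hf x).unique h hxy ((f x).2.trans hy.symm)

/-- The bipartite graphs between the layers have one of the four non-universal forms. -/
def HasFourForms (G : ThreeGraph V) (a : Fin 3) (layer : V → Fin k) : Prop :=
  ∀ i j : Fin k, i ≠ j →
    Bip.IsFull (G.between a layer i j) ∨
    Bip.IsEdgeless (G.between a layer i j) ∨
    Bip.IsPerfectMatching (G.between a layer i j) ∨
    Bip.IsPerfectMatching (Bip.compl (G.between a layer i j))

theorem HasFourForms.cases (hff : G.HasFourForms a layer) {i j : Fin k} (hij : i ≠ j) :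
    Bip.IsMatchingType (G.between a layer i j) ∨ Bip.IsFull (G.between a layer i j) ∨
      Bip.IsEdgeless (G.between a layer i j) := by
  have := hff i j hij
  unfold Bip.IsMatchingType
  tauto

theorem isMatchingType_between_symm {i j : Fin k}
    (hij : Bip.IsMatchingType (G.between a layer i j)) :
    Bip.IsMatchingType (G.between a layer j i) := by
  rw [← flip_between]
  exact hij.flip

/-- Otherwise the layers `i` and `l` are joined uniformly, so homogeneity over a fixed `x` in layer
`i` connects `x` to every `z` in layer `l` through a common partner. But `x` has at most one partner
in each of the finitely many layers, and each of these has at most one partner in layer `l`, which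
is infinite. -/
theorem isMatchingType_between_trans (h : G.IsLayering c layer) (hG : G.IsHomogeneous)
    (hac : a ≠ c) (hff : G.HasFourForms a layer) {i j l : Fin k} (hij : i ≠ j) (hil : i ≠ l)
    (hjl : j ≠ l) (mij : Bip.IsMatchingType (G.between a layer i j))
    (mjl : Bip.IsMatchingType (G.between a layer j l)) :
    Bip.IsMatchingType (G.between a layer i l) := by
  classical
  rcases hff.cases hil with m | huni
  · exact m
  exfalso
  obtain ⟨f, hf⟩ := Bip.isMatchingType_iff.1 mij
  obtain ⟨g, hg⟩ := Bip.isMatchingType_iff.1 mjl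
  obtain ⟨x⟩ := h.nonempty_layer i
  -- all pairs from the two layers look alike
  have adj : ∀ z z' : Layer layer l, (G.color a).Adj x z ↔ (G.color a).Adj x z' := by
    intro z z'
    rcases huni with H | H
    · exact iff_of_true (H x z) (H x z')
    · exact iff_of_false (H x z) (H x z')
  have hne : ∀ z : Layer layer l, (x : V) ≠ z := fun z e =>
    hil (x.2.symm.trans ((congrArg layer e).trans z.2))
  have ncol : ∀ z : Layer layer l, ¬ (G.color c).Adj x z := fun z e =>
    hil (x.2.symm.trans (((h.adj_iff _ _).1 e).2.trans z.2))
  have col : ∀ (d : Fin 3) (z z' : Layer layer l),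
      (G.color d).Adj x z ↔ (G.color d).Adj x z' := fun d z z' =>
    adj_iff_of_two hac (iff_of_true (hne z) (hne z')) (adj z z')
      (iff_of_false (ncol z) (ncol z')) d
  let z₀ : Layer layer l := g (f x)
  have move : ∀ z : Layer layer l, ∃ y, G.IsPartner a layer x y ∧ G.IsPartner a layer y z := by
    intro z
    have hz₀ := (hne z₀).symm
    have hz := (hne z).symm
    obtain ⟨p, hp, hpS⟩ := hG.exists_extend {(x : V), (z₀ : V)}
      (fun w => if w = x then x else z) (by
        intro s hs t ht hst
        simp only [Finset.coe_insert, Finset.coe_singleton, Set.mem_insert_iff,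
          Set.mem_singleton_iff] at hs ht
        grind) (by
        intro d s hs t ht
        simp only [Finset.mem_insert, Finset.mem_singleton] at hs ht
        rcases hs with rfl | rfl <;> rcases ht with rfl | rfl
        · simp
        · simpa [hz₀] using col d z₀ z
        · simpa [hz₀, SimpleGraph.adj_comm] using col d z₀ z
        · simp)
    have hpx : p x = x := by simpa using hpS x (by simp)
    have hpz : p z₀ = z := by simpa [hz₀] using hpS z₀ (by simp)
    refine ⟨p (f x), ?_, ?_⟩
    · have := (isPartner_of_determines hij hf x).map h hp
      rwa [hpx] at this
    · have := (isPartner_of_determines hjl hg (f x)).map h hp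
      rwa [← hpz]
  choose y hxy hyz using move
  have inj : Function.Injective fun z => layer (y z) := by
    intro z z' hzz
    have e : y z = y z' := (hxy z).unique h (hxy z') hzz
    have hz := hyz z
    rw [e] at hz
    exact Subtype.ext (hz.unique h (hyz z') (z.2.trans z'.2.symm))
  have := h.infinite_layer l
  exact not_injective_infinite_finite _ inj

/-- A layer-preserving automorphism that fixes `x` fixes its partner `f x`, then `g (f x)`, then the
`f'`-preimage `x'` of that. If `x'` were not `x`, it could be moved with `x` held fixed. -/
theorem determines_comp (h : G.IsLayering c layer) (hG : G.IsHomogeneous)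
    {i j l : Fin k} (hij : i ≠ j) (hil : i ≠ l) (hjl : j ≠ l)
    {f : Layer layer i ≃ Layer layer j} {g : Layer layer j ≃ Layer layer l}
    {f' : Layer layer i ≃ Layer layer l}
    (hf : Bip.Determines (G.between a layer i j) f)
    (hg : Bip.Determines (G.between a layer j l) g)
    (hf' : Bip.Determines (G.between a layer i l) f') (x : Layer layer i) : g (f x) = f' x := by
  classical
  by_contra hne
  obtain ⟨x', hx'⟩ := f'.surjective (g (f x))
  have hxx' : (x' : V) ≠ x := by
    intro e
    rw [Subtype.ext e] at hx'
    exact hne hx'.symm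
  obtain ⟨w, hw, hwn⟩ := h.exists_notMem i {(x : V), (x' : V)}
  simp only [Finset.mem_insert, Finset.mem_singleton, not_or] at hwn
  obtain ⟨p, hp, hpl, hpx, hpw⟩ := h.exists_fixing hG (i := i) (S := {(x : V)}) (u := x')
    (w := w) (by simpa using x.2) x'.2 hw (by simpa using hxx') (by simpa using hwn.1)
  have hpx : p x = x := hpx x (by simp)
  have h1 := isPartner_of_determines hij hf x
  have h2 := isPartner_of_determines hjl hg (f x)
  have e1 : p (f x) = f x := by
    have := h1.map h hp
    rw [hpx] at this
    exact this.unique h h1 (hpl _)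
  have e2 : p (g (f x)) = g (f x) := by
    have := h2.map h hp
    rw [e1] at this
    exact this.unique h h2 (hpl _)
  have h3 := isPartner_of_determines hil hf' x'
  rw [hx'] at h3
  have h4 := h3.map h hp
  rw [e2, hpw] at h4
  have e3 := IsPartner.eq_of_determines h hil hf' (x := ⟨w, hw⟩) (g (f x)).2 h4
  have e4 := f'.injective ((Subtype.ext e3).trans hx'.symm)
  exact hwn.2 (congrArg Subtype.val e4)

/-- By transitivity the graphs from `i` and `j` to `l` are both of type 2 or both constant. In the
first case the bijections compose, and the alternative depends on whether both graphs are matchings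
or both complements; in the second it depends on whether the two constants agree. -/
theorem between_iff_or_not_iff (h : G.IsLayering c layer) (hG : G.IsHomogeneous)
    (hac : a ≠ c) (hff : G.HasFourForms a layer) {i j l : Fin k} (hij : i ≠ j) (hil : i ≠ l)
    (hjl : j ≠ l) {f : Layer layer i ≃ Layer layer j}
    (hf : Bip.Determines (G.between a layer i j) f) :
    (∀ x y, G.between a layer i l x y ↔ G.between a layer j l (f x) y) ∨
    (∀ x y, ¬ G.between a layer i l x y ↔ G.between a layer j l (f x) y) := by
  have mij : Bip.IsMatchingType (G.between a layer i j) := Bip.isMatchingType_iff.2 ⟨f, hf⟩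
  have both : Bip.IsMatchingType (G.between a layer i l) →
      Bip.IsMatchingType (G.between a layer j l) →
      (∀ x y, G.between a layer i l x y ↔ G.between a layer j l (f x) y) ∨
      (∀ x y, ¬ G.between a layer i l x y ↔ G.between a layer j l (f x) y) := by
    intro mil mjl
    obtain ⟨f', hf'⟩ := Bip.isMatchingType_iff.1 mil
    obtain ⟨g, hg⟩ := Bip.isMatchingType_iff.1 mjl
    have comp := determines_comp h hG hij hil hjl hf hg hf'
    rcases hf' with H | H <;> rcases hg with H' | H'
    · exact Or.inl fun x y => by rw [H, H', comp]
    · refine Or.inr fun x y => ?_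
      have := H' (f x) y
      rw [comp, ← H, Bip.compl] at this
      tauto
    · refine Or.inr fun x y => ?_
      have := H x y
      rw [← comp, ← H', Bip.compl] at this
      exact this
    · refine Or.inl fun x y => not_iff_not.1 ?_
      have := H x y
      rw [← comp, ← H', Bip.compl, Bip.compl] at this
      exact this
  rcases hff.cases hil with mil | hil'
  · exact both mil (isMatchingType_between_trans h hG hac hff hij.symm hjl hil
      (isMatchingType_between_symm mij) mil)
  rcases hff.cases hjl with mjl | hjl'
  · exact both (isMatchingType_between_trans h hG hac hff hij hil hjl mij mjl) mjl
  rcases hil' with H | H <;> rcases hjl' with H' | H'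
  · exact Or.inl fun x y => iff_of_true (H x y) (H' (f x) y)
  · exact Or.inr fun x y => iff_of_false (not_not.2 (H x y)) (H' (f x) y)
  · exact Or.inr fun x y => iff_of_true (H x y) (H' (f x) y)
  · exact Or.inl fun x y => iff_of_false (H x y) (H' (f x) y)

/-- A full or edgeless graph admits no exceptional vertex, so a single pair of partners determines
the form of the whole graph. -/
theorem IsPartner.isMatchingType (h : G.IsLayering c layer) (hff : G.HasFourForms a layer)
    {x y : V} (hxy : G.IsPartner a layer x y) :
    Bip.IsMatchingType (G.between a layer (layer x) (layer y)) := by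
  classical
  rcases hff.cases hxy.1 with m | H
  · exact m
  exfalso
  obtain ⟨z, hz, hzy⟩ := h.exists_notMem (layer y) {y}
  rw [Finset.mem_singleton] at hzy
  have e : (G.color a).Adj x y ↔ (G.color a).Adj x z := by
    rcases H with H | H
    · exact iff_of_true (H ⟨x, rfl⟩ ⟨y, rfl⟩) (H ⟨x, rfl⟩ ⟨z, hz⟩)
    · exact iff_of_false (H ⟨x, rfl⟩ ⟨y, rfl⟩) (H ⟨x, rfl⟩ ⟨z, hz⟩)
  rcases hxy.2 with K | K <;> have k1 := K y rfl <;> have k2 := K z hz <;> tauto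

theorem IsPartner.symm (h : G.IsLayering c layer) (hff : G.HasFourForms a layer)
    {x y : V} (hxy : G.IsPartner a layer x y) : G.IsPartner a layer y x := by
  obtain ⟨f, hf⟩ := Bip.isMatchingType_iff.1 (hxy.isMatchingType h hff)
  have e : f ⟨x, rfl⟩ = ⟨y, rfl⟩ :=
    Subtype.ext (IsPartner.eq_of_determines h hxy.1 hf (x := ⟨x, rfl⟩) rfl hxy)
  have hf' := hf.flip
  rw [flip_between] at hf'
  have := isPartner_of_determines hxy.1.symm hf' ⟨y, rfl⟩
  rwa [← e, Equiv.symm_apply_apply, e] at this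

theorem IsPartner.trans (h : G.IsLayering c layer) (hG : G.IsHomogeneous) (hac : a ≠ c)
    (hff : G.HasFourForms a layer) {x y z : V} (hxy : G.IsPartner a layer x y)
    (hyz : G.IsPartner a layer y z) (hxz : layer x ≠ layer z) : G.IsPartner a layer x z := by
  have mxy := hxy.isMatchingType h hff
  have myz := hyz.isMatchingType h hff
  obtain ⟨f, hf⟩ := Bip.isMatchingType_iff.1 mxy
  obtain ⟨g, hg⟩ := Bip.isMatchingType_iff.1 myz
  obtain ⟨f', hf'⟩ := Bip.isMatchingType_iff.1
    (isMatchingType_between_trans h hG hac hff hxy.1 hxz hyz.1 mxy myz)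
  have e := determines_comp h hG hxy.1 hxz hyz.1 hf hg hf' ⟨x, rfl⟩
  have e1 : f ⟨x, rfl⟩ = ⟨y, rfl⟩ :=
    Subtype.ext (IsPartner.eq_of_determines h hxy.1 hf (x := ⟨x, rfl⟩) rfl hxy)
  have e2 : g ⟨y, rfl⟩ = ⟨z, rfl⟩ :=
    Subtype.ext (IsPartner.eq_of_determines h hyz.1 hg (x := ⟨y, rfl⟩) rfl hyz)
  have := isPartner_of_determines hxz hf' ⟨x, rfl⟩
  rwa [← e, e1, e2] at this

end ThreeGraph

/-! ### Coordinates and slices -/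

namespace ThreeGraph

variable {V : Type u} {G : ThreeGraph V} {a c : Fin 3} {k : ℕ} {layer : V → Fin k}

/-- The coordinates `e` present `G` as `ℕ` slices, each with one vertex in every layer, such that
the colour of a pair depends only on the two layers and on whether the slices agree. -/
structure IsCoordinates (G : ThreeGraph V) (a : Fin 3) (layer : V → Fin k) (e : Fin k × ℕ ≃ V) :
    Prop where
  layer_apply : ∀ q, layer (e q) = q.1
  isPartner : ∀ i j n, i ≠ j → Bip.IsMatchingType (G.between a layer i j) →
    G.IsPartner a layer (e (i, n)) (e (j, n))
  adj_iff : ∀ (d : Fin 3) (i j : Fin k) (n m n' m' : ℕ), (n = m ↔ n' = m') →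
    ((G.color d).Adj (e (i, n)) (e (j, m)) ↔ (G.color d).Adj (e (i, n')) (e (j, m')))

theorem adj_iff_of_isPartner (h : G.IsLayering c layer) (hac : a ≠ c)
    (hff : G.HasFourForms a layer) {e : Fin k × ℕ ≃ V} (he : ∀ q, layer (e q) = q.1)
    (hep : ∀ i j n, i ≠ j → Bip.IsMatchingType (G.between a layer i j) →
      G.IsPartner a layer (e (i, n)) (e (j, n)))
    (d : Fin 3) (i j : Fin k) {n m n' m' : ℕ} (hnm : n = m ↔ n' = m') :
    (G.color d).Adj (e (i, n)) (e (j, m)) ↔ (G.color d).Adj (e (i, n')) (e (j, m')) := by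
  by_cases hij : i = j
  · subst hij
    rw [h.adj_iff_of_layer_eq (by rw [he, he]), h.adj_iff_of_layer_eq (by rw [he, he]), ne_eq,
      ne_eq, e.apply_eq_iff_eq, e.apply_eq_iff_eq, Prod.mk.injEq, Prod.mk.injEq, hnm]
  have nc : ∀ n m, ¬ (G.color c).Adj (e (i, n)) (e (j, m)) := fun n m hc => by
    have := ((h.adj_iff _ _).1 hc).2
    rw [he, he] at this
    exact hij this
  have nn : ∀ n m, e (i, n) ≠ e (j, m) := fun n m hc => by
    simpa [hij] using e.injective hc
  refine adj_iff_of_two hac (iff_of_true (nn _ _) (nn _ _)) ?_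
    (iff_of_false (nc _ _) (nc _ _)) d
  rcases hff.cases hij with hm | H | H
  · obtain ⟨f, hf⟩ := Bip.isMatchingType_iff.1 hm
    have key : ∀ n m, f ⟨e (i, n), he _⟩ = ⟨e (j, m), he _⟩ ↔ n = m := fun n m => by
      rw [Subtype.ext_iff, IsPartner.eq_of_determines h hij hf (he _) (hep i j n hij hm),
        e.apply_eq_iff_eq, Prod.mk.injEq]
      simp
    rcases hf with H | H
    · have h1 := H ⟨e (i, n), he _⟩ ⟨e (j, m), he _⟩
      have h2 := H ⟨e (i, n'), he _⟩ ⟨e (j, m'), he _⟩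
      rw [key] at h1 h2
      exact h1.trans (hnm.trans h2.symm)
    · have h1 := H ⟨e (i, n), he _⟩ ⟨e (j, m), he _⟩
      have h2 := H ⟨e (i, n'), he _⟩ ⟨e (j, m'), he _⟩
      rw [key] at h1 h2
      exact not_iff_not.1 (h1.trans (hnm.trans h2.symm))
  · exact iff_of_true (H ⟨_, he (i, n)⟩ ⟨_, he (j, m)⟩) (H ⟨_, he (i, n')⟩ ⟨_, he (j, m')⟩)
  · exact iff_of_false (H ⟨_, he (i, n)⟩ ⟨_, he (j, m)⟩) (H ⟨_, he (i, n')⟩ ⟨_, he (j, m')⟩)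

theorem exists_isCoordinates [Countable V] (h : G.IsLayering c layer) (hG : G.IsHomogeneous)
    (hac : a ≠ c) (hff : G.HasFourForms a layer) :
    ∃ e : Fin k × ℕ ≃ V, G.IsCoordinates a layer e := by
  classical
  -- Layers linked by type 2 graphs form classes. All layers of a class take their numbering from
  -- the same representative `rep i`, which makes the numberings agree along the bijections.
  let s : Setoid (Fin k) :=
    { r := fun i j => i = j ∨ Bip.IsMatchingType (G.between a layer i j)
      iseqv :=
        { refl := fun _ => Or.inl rfl
          symm := fun H => H.imp Eq.symm isMatchingType_between_symm
          trans := fun {i j l} H H' => by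
            by_cases hij : i = j
            · rwa [hij]
            by_cases hjl : j = l
            · rwa [← hjl]
            by_cases hil : i = l
            · exact Or.inl hil
            exact Or.inr (isMatchingType_between_trans h hG hac hff hij hil hjl
              (H.resolve_left hij) (H'.resolve_left hjl)) } }
  let rep : Fin k → Fin k := fun i => (Quotient.mk s i).out
  have hrep : ∀ i, rep i = i ∨ Bip.IsMatchingType (G.between a layer (rep i) i) :=
    fun i => Quotient.mk_out (s := s) i
  have hrep' : ∀ i j, Bip.IsMatchingType (G.between a layer i j) → rep i = rep j := fun i j hij =>
    congrArg Quotient.out (Quotient.sound (s := s) (Or.inr hij))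
  have link : ∀ r i, r = i ∨ Bip.IsMatchingType (G.between a layer r i) →
      ∃ φ : Layer layer r ≃ Layer layer i,
        ∀ x : Layer layer r, (x : V) = φ x ∨ G.IsPartner a layer x (φ x) := by
    intro r i hri
    by_cases hi : r = i
    · subst hi
      exact ⟨Equiv.refl _, fun _ => Or.inl rfl⟩
    obtain ⟨f, hf⟩ := Bip.isMatchingType_iff.1 (hri.resolve_left hi)
    exact ⟨f, fun x => Or.inr (isPartner_of_determines hi hf x)⟩
  choose φ hφ using fun i => link (rep i) i (hrep i)
  have enum : ∀ i, Nonempty (ℕ ≃ Layer layer i) := fun i => by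
    have := h.infinite_layer i
    exact nonempty_equiv_of_countable
  let E : ∀ i, ℕ ≃ Layer layer i := fun i => (enum (rep i)).some.trans (φ i)
  let e : Fin k × ℕ ≃ V :=
    (Equiv.sigmaEquivProd (Fin k) ℕ).symm.trans
      ((Equiv.sigmaCongrRight E).trans (Equiv.sigmaFiberEquiv layer))
  have he_eq : ∀ i n, e (i, n) = E i n := fun _ _ => rfl
  have he : ∀ q, layer (e q) = q.1 := fun q => (E q.1 q.2).2
  have hep : ∀ i j n, i ≠ j → Bip.IsMatchingType (G.between a layer i j) →
      G.IsPartner a layer (e (i, n)) (e (j, n)) := by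
    intro i j n hij hm
    have hne : layer (e (i, n)) ≠ layer (e (j, n)) := by rwa [he, he]
    have key : ∀ i, ∃ w : V, w = (enum (rep i)).some n ∧
        (w = e (i, n) ∨ G.IsPartner a layer w (e (i, n))) := fun i =>
      ⟨_, rfl, hφ i ((enum (rep i)).some n)⟩
    obtain ⟨w, hw, hwi⟩ := key i
    -- Both vertices with number `n` equal, or are partners of, the same `n`-th vertex of the
    -- representative layer.
    obtain ⟨w', hw', hwj⟩ := key j
    rw [← hrep' i j hm, ← hw] at hw'
    subst hw'
    rcases hwi with hwi | hwi <;> rcases hwj with hwj | hwj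
    · exact absurd (congrArg layer (hwi.symm.trans hwj)) hne
    · rwa [← hwi]
    · rw [← hwj]
      exact hwi.symm h hff
    · exact (hwi.symm h hff).trans h hG hac hff hwj hne
  exact ⟨e, he, hep, fun d i j n m n' m' hnm => adj_iff_of_isPartner h hac hff he hep d i j hnm⟩

theorem IsCoordinates.isSlicing (h : G.IsLayering c layer) {e : Fin k × ℕ ≃ V}
    (he : G.IsCoordinates a layer e) : G.IsSlicing a layer fun n => {x | (e.symm x).2 = n} := by
  have layer_eq : ∀ x, layer x = (e.symm x).1 := fun x => by
    rw [← he.layer_apply, e.apply_symm_apply]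
  refine ⟨?_, ?_, ?_, ?_, ?_⟩
  · ext x
    simp
  · intro m n hmn
    rw [Set.disjoint_left]
    rintro x rfl h2
    exact hmn h2
  · intro n i
    refine ⟨e (i, n), ⟨by simp, he.layer_apply _⟩, ?_⟩
    rintro x ⟨hx, hxi⟩
    rw [layer_eq] at hxi
    rw [← hxi, ← hx, e.apply_symm_apply]
  · intro i j hij f hf n x hx
    have hx1 : (x : V) = e (i, n) := by
      have h1 : (e.symm x).2 = n := hx
      have h2 : (e.symm x).1 = i := (layer_eq x).symm.trans x.2
      exact e.symm_apply_eq.1 (Prod.ext h2 h1)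
    have hp := he.isPartner i j n hij (Bip.isMatchingType_iff.2 ⟨f, hf⟩)
    rw [← hx1] at hp
    rw [IsPartner.eq_of_determines h hij hf (he.layer_apply _) hp]
    simp
  · intro m n
    let p : V ≃ V :=
      e.symm.trans ((Equiv.prodCongr (Equiv.refl (Fin k)) (Equiv.swap m n)).trans e)
    have hp : ∀ x, p x = e ((e.symm x).1, Equiv.swap m n (e.symm x).2) := fun _ => rfl
    have hps : ∀ x, (e.symm (p x)).2 = Equiv.swap m n (e.symm x).2 := fun x => by simp [hp]
    have hpp : ∀ x, p (p x) = x := fun x => by simp [hp]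
    refine ⟨p, ?_, ?_, ?_, ?_, ?_⟩
    · intro d x y
      have := he.adj_iff d (e.symm x).1 (e.symm y).1 (e.symm x).2 (e.symm y).2
        (Equiv.swap m n (e.symm x).2) (Equiv.swap m n (e.symm y).2)
        ((Equiv.swap m n).apply_eq_iff_eq).symm
      simpa [hp] using this
    · intro x
      rw [hp, he.layer_apply, layer_eq]
    · ext x
      constructor
      · rintro ⟨y, rfl, rfl⟩
        simp [hps]
      · rintro rfl
        exact ⟨p x, by simp [hps], hpp x⟩
    · ext x
      constructor
      · rintro ⟨y, rfl, rfl⟩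
        simp [hps]
      · rintro rfl
        exact ⟨p x, by simp [hps], hpp x⟩
    · intro x hm hn
      rw [hp, Equiv.swap_apply_of_ne_of_ne hm hn, e.apply_symm_apply]

end ThreeGraph

/-! ### Well quasi-ordering of labelled structures -/

theorem wellQuasiOrderedLE_withBot (X : Type v) [Preorder X] [WellQuasiOrderedLE X] :
    WellQuasiOrderedLE (WithBot X) := by
  refine ⟨fun f => ?_⟩
  by_cases hf : ∃ m, f m = ⊥
  · obtain ⟨m, hm⟩ := hf
    exact ⟨m, m + 1, Nat.lt_succ_self m, by simp [hm]⟩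
  push Not at hf
  choose g hg using fun m => WithBot.ne_bot_iff_exists.1 (hf m)
  obtain ⟨m, n, hmn, hle⟩ := wellQuasiOrdered_le g
  exact ⟨m, n, hmn, by rw [← hg, ← hg]; exact WithBot.coe_le_coe.2 hle⟩

theorem List.SublistForall₂.exists_injective {α : Type u} {β : Type v} {R : α → β → Prop}
    {l : List α} {l' : List β} (h : List.SublistForall₂ R l l') :
    ∃ φ : Fin l.length → Fin l'.length, Function.Injective φ ∧ ∀ n, R (l.get n) (l'.get (φ n)) := by
  induction h with
  | nil => exact ⟨fun n => n.elim0, fun n => n.elim0, fun n => n.elim0⟩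
  | @cons x y l l' hxy _ ih =>
    obtain ⟨φ, hφ, hR⟩ := ih
    refine ⟨Fin.cases (0 : Fin (l'.length + 1)) fun n => (φ n).succ, ?_, ?_⟩
    · intro n m
      refine Fin.cases ?_ (fun n => ?_) n <;> refine Fin.cases ?_ (fun m => ?_) m
      · simp
      · intro h0
        exact absurd h0.symm (Fin.succ_ne_zero _)
      · intro h0
        exact absurd h0 (Fin.succ_ne_zero _)
      · intro h0
        exact congrArg Fin.succ (hφ (Fin.succ_injective _ h0))
    · intro n
      refine Fin.cases ?_ (fun n => ?_) n
      · exact hxy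
      · exact hR n
  | @cons_right y l l' _ ih =>
    obtain ⟨φ, hφ, hR⟩ := ih
    exact ⟨fun n => (φ n).succ, (Fin.succ_injective _).comp hφ, hR⟩

namespace ThreeGraph

variable {V : Type u} {G : ThreeGraph V} {a : Fin 3} {k : ℕ} {layer : V → Fin k}

open Classical in
/-- The labels on the `n`-th slice of a labelled structure placed in `G` by `h`. -/
noncomputable def sliceLabel {X : Type v} (e : Fin k × ℕ ≃ V) (S : LabelledAge G X)
    (h : S.carrier → V) (n : ℕ) (i : Fin k) : WithBot X :=
  if hx : ∃ x, h x = e (i, n) then (S.label hx.choose : WithBot X) else ⊥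

theorem sliceLabel_apply {X : Type v} {e : Fin k × ℕ ≃ V} {S : LabelledAge G X}
    {h : S.carrier → V} (hh : Function.Injective h) {x : S.carrier} {n : ℕ} {i : Fin k}
    (hx : h x = e (i, n)) : sliceLabel e S h n i = S.label x := by
  have hex : ∃ x, h x = e (i, n) := ⟨x, hx⟩
  rw [sliceLabel, dif_pos hex]
  congr 2
  exact hh (hex.choose_spec.trans hx.symm)

/-- Since `⊥` marks an absent vertex and lies below every label, domination of letters forces a
present vertex to be sent to a present one. -/
theorem exists_of_le_sliceLabel {X : Type v} [Preorder X] {e : Fin k × ℕ ≃ V}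
    {S : LabelledAge G X} {h : S.carrier → V} {n : ℕ} {i : Fin k} {t : X}
    (ht : (t : WithBot X) ≤ sliceLabel e S h n i) : ∃ x, h x = e (i, n) ∧ t ≤ S.label x := by
  rw [sliceLabel] at ht
  split_ifs at ht with hex
  · exact ⟨_, hex.choose_spec, WithBot.coe_le_coe.1 ht⟩
  · exact absurd ht (WithBot.not_coe_le_bot t)

theorem IsCoordinates.admitsWQO {e : Fin k × ℕ ≃ V} (he : G.IsCoordinates a layer e) :
    AdmitsWQO.{u, v} G := by
  intro X _ _
  have := wellQuasiOrderedLE_withBot X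
  choose h hh using fun S : LabelledAge G X => S.mem_age
  have bound : ∀ S : LabelledAge G X, ∃ N, ∀ x, (e.symm (h S x)).2 < N := fun S => by
    have := S.finite
    obtain ⟨N, hN⟩ := (Set.finite_range fun x => (e.symm (h S x)).2).bddAbove
    exact ⟨N + 1, fun x => Nat.lt_succ_of_le (hN ⟨x, rfl⟩)⟩
  choose N hN using bound
  have dickson : (Set.univ : Set (Fin k → WithBot X)).PartiallyWellOrderedOn (· ≤ ·) :=
    Set.partiallyWellOrderedOn_univ_iff.2
      (WellQuasiOrdered.pi fun _ : Fin k => wellQuasiOrdered_le (α := WithBot X))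
  have higman := Set.PartiallyWellOrderedOn.partiallyWellOrderedOn_sublistForall₂ _ dickson
  refine ⟨fun F => ?_⟩
  -- The word of a structure runs over slices `0` to `N - 1`, which contain its whole image; empty
  -- slices among them do no harm.
  obtain ⟨s, t, hst, hle⟩ := Set.partiallyWellOrderedOn_iff_exists_lt.1 higman
    (fun n => (List.range (N (F n))).map (sliceLabel e (F n) (h (F n)))) (by simp)
  refine ⟨s, t, hst, ?_⟩
  generalize F s = S at hle
  generalize F t = T at hle
  rw [List.sublistForall₂_map_left_iff, List.sublistForall₂_map_right_iff] at hle
  obtain ⟨φ, hφ, hR⟩ := hle.exists_injective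
  have slot : ∀ x, (e.symm (h S x)).2 < (List.range (N S)).length := fun x => by
    simpa using hN S x
  have image : ∀ x, ∃ y, h T y = e ((e.symm (h S x)).1, φ ⟨_, slot x⟩) ∧
      S.label x ≤ T.label y := by
    intro x
    have h1 := hR ⟨_, slot x⟩ (e.symm (h S x)).1
    simp only [List.get_eq_getElem, List.getElem_range] at h1
    rw [sliceLabel_apply (hh S).1 (x := x) (by simp)] at h1
    exact exists_of_le_sliceLabel h1
  choose g hg hgl using image
  -- Colors see only the layers and whether the slices agree, so the injectivity of `φ` suffices for
  -- an embedding; the order of the slices is irrelevant.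
  have hφ' : ∀ x y, (e.symm (h S x)).2 = (e.symm (h S y)).2 ↔
      ((φ ⟨_, slot x⟩ : ℕ) = φ ⟨_, slot y⟩) := fun x y => by
    rw [← Fin.ext_iff, hφ.eq_iff, Fin.mk.injEq]
  refine ⟨g, ⟨fun x y hxy => ?_, fun d x y => ?_⟩, hgl⟩
  · have h1 := hg x
    rw [hxy, hg y, e.apply_eq_iff_eq, Prod.mk.injEq] at h1
    exact (hh S).1 (e.symm.injective (Prod.ext h1.1.symm ((hφ' x y).2 h1.2.symm)))
  · rw [(hh S).2, (hh T).2, hg, hg, ← he.adj_iff d _ _ _ _ _ _ (hφ' x y)]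
    simp

end ThreeGraph
theorem mainTheorem7 {V : Type u} [Countable V] [Infinite V] (G : ThreeGraph V)
    (hG : G.IsHomogeneous) (a c : Fin 3) (hac : a ≠ c)
    {k : ℕ} (layer : V → Fin k) (hlayer : G.IsLayering c layer)
    (hnu : ∀ i j : Fin k, i ≠ j → ¬ Bip.IsUniversal (G.between a layer i j)) :
    -- each bipartite graph between two layers has one of four forms
    (∀ i j : Fin k, i ≠ j →
      Bip.IsFull (G.between a layer i j) ∨
      Bip.IsEdgeless (G.between a layer i j) ∨
      Bip.IsPerfectMatching (G.between a layer i j) ∨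
      Bip.IsPerfectMatching (Bip.compl (G.between a layer i j))) ∧
    -- a matching bijection carries the edges to a third layer to edges, or to non-edges
    (∀ i j l : Fin k, i ≠ j → i ≠ l → j ≠ l →
      ∀ f : ThreeGraph.Layer layer i ≃ ThreeGraph.Layer layer j,
        Bip.Determines (G.between a layer i j) f →
        (∀ x y, G.between a layer i l x y ↔ G.between a layer j l (f x) y) ∨
        (∀ x y, ¬ G.between a layer i l x y ↔ G.between a layer j l (f x) y)) ∧
    -- being linked by a matching is transitive on layers
    (∀ i j l : Fin k, i ≠ j → i ≠ l → j ≠ l →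
      Bip.IsMatchingType (G.between a layer i j) →
      Bip.IsMatchingType (G.between a layer j l) →
      Bip.IsMatchingType (G.between a layer i l)) ∧
    -- the matching bijections compose
    (∀ i j l : Fin k, i ≠ j → i ≠ l → j ≠ l →
      ∀ (f : ThreeGraph.Layer layer i ≃ ThreeGraph.Layer layer j)
        (g : ThreeGraph.Layer layer j ≃ ThreeGraph.Layer layer l)
        (h : ThreeGraph.Layer layer i ≃ ThreeGraph.Layer layer l),
        Bip.Determines (G.between a layer i j) f →
        Bip.Determines (G.between a layer j l) g →
        Bip.Determines (G.between a layer i l) h →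
        ∀ x, g (f x) = h x) ∧
    -- the vertex set is cut into slices
    (∃ U : ℕ → Set V, G.IsSlicing a layer U) ∧
    ThreeGraph.AdmitsWQO.{u, v} G := by
  have hff : G.HasFourForms a layer := fun i j hij => hlayer.four_forms hG (hnu i j hij)
  obtain ⟨e, he⟩ := ThreeGraph.exists_isCoordinates hlayer hG hac hff
  exact ⟨hff,
    fun i j l hij hil hjl f hf =>
      ThreeGraph.between_iff_or_not_iff hlayer hG hac hff hij hil hjl hf,
    fun i j l hij hil hjl mij mjl =>
      ThreeGraph.isMatchingType_between_trans hlayer hG hac hff hij hil hjl mij mjl,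
    fun i j l hij hil hjl f g f' hf hg hf' x =>
      ThreeGraph.determines_comp hlayer hG hij hil hjl hf hg hf' x,
    ⟨_, he.isSlicing hlayer⟩, he.admitsWQO⟩
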